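/- Let $k\ge 2$, $m\ge 1$. A dataset of $s$ users is $x\in([k]^m)^s$, each user $u$ holding $m$ samples $x_1(u),\dots,x_m(u)\in[k]$; its aggregate count vector is $N(x)=(N_1,\dots,N_k)$, where $N_i$ is the number of pairs $(u,j)$ with $x_j(u)=i$. An algorithm $A$ gives, for every number of users $s\ge 0$, a randomized estimator $\hat p^A$ that maps datasets of $s$ users to vectors in $\mathbb R^k$ (for example, to probability vectors). It is (user-level) $(\varepsilon,\delta)$-differentially private if for every $s$, any two datasets $x,y$ of $s$ users that differ only in the data of a single user, and every measurable $S$, $\Pr[\hat p^A(x)\in S]\le e^{\varepsilon}\Pr[\hat p^A(y)\in S]+\delta$. It operates only on the aggregate counts if for every $s$ the law of $\hat p^A(x)$ is a function of $N(x)$. The user complexity $S^A_{m,\alpha}\in\{0,1,2,\dots\}\cup\{\infty\}$ is the least $s$ such that $\mathbb E\,\|p-\hat p^A(X)\|_1\le\alpha$ for all probability distributions $p$ on $[k]$, where $X$ consists of $sm$ i.i.d. samples from $p$ and the expectation is over $X$ and the randomness of $A$ ($S^A_{m,\alpha}=\infty$ if there is no such $s$). **Theorem.** There is an absolute constant $C>0$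 such that for all integers $k\ge 2$, $m\ge 1$, all $\alpha\in(0,1/6)$, all $\varepsilon,\delta\ge 0$ with $\varepsilon+\delta\le 0.07$, and every $(\varepsilon,\delta)$-differentially private algorithm $A$ that operates only on the aggregate counts, $$S^A_{m,\alpha}\ \ge\ C\left(\frac{k}{m\alpha^2}+\frac{k}{\alpha(\varepsilon+\delta)}\right),$$ where the right-hand side is $\infty$ if $\varepsilon=\delta=0$. In particular the privacy term does not decrease with $m$. -/

import Mathlib

open MeasureTheory
open scoped ENNReal

namespace UserLevelDP

/-- A dataset of `s` users, each holding `m` samples over the `k` symbols: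
`x u j` is the `j`-th sample of user `u`. -/
abbrev Dataset (s m k : ℕ) : Type := Fin s → Fin m → Fin k

/-- A randomized mechanism with inputs in `D` and outputs in `R`, given by the law of the output
on each input. -/
abbrev Mechanism (D R : Type*) [MeasurableSpace R] : Type _ := D → ProbabilityMeasure R

/-- User-level adjacency: the datasets agree except possibly in the data of a single user. -/
def Adjacent {s m k : ℕ} (x y : Dataset s m k) : Prop :=
  ∃ u : Fin s, ∀ v : Fin s, v ≠ u → x v = y v

/-- User-level `(ε, δ)`-differential privacy. -/
def IsDP {s m k : ℕ} {R : Type*} [MeasurableSpace R] (ε δ : ℝ)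
    (M : Mechanism (Dataset s m k) R) : Prop :=
  ∀ x y : Dataset s m k, Adjacent x y → ∀ S : Set R, MeasurableSet S →
    (M x : Measure R) S ≤
      ENNReal.ofReal (Real.exp ε) * (M y : Measure R) S + ENNReal.ofReal δ

/-- `M` is `f`-restricted: it has access to its input `x` only through `f x`. -/
def IsRestricted {D Y R : Type*} [MeasurableSpace R] (f : D → Y) (M : Mechanism D R) : Prop :=
  ∃ M' : Mechanism Y R, ∀ x : D, M x = M' (f x)

/-- The count vector `N(u)` of one user's samples. -/
def userCounts {m k : ℕ} (z : Fin m → Fin k) : Fin k → ℕ :=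
  fun i => (Finset.univ.filter fun j : Fin m => z j = i).card

/-- The aggregate count vector `N = ∑ u, N(u)`. -/
def totalCounts {s m k : ℕ} (x : Dataset s m k) : Fin k → ℕ :=
  ∑ u : Fin s, userCounts (x u)

/-- The probability of the dataset `x` when all `s * m` samples are i.i.d. from `p`. -/
def sampleProb {s m k : ℕ} (p : Fin k → ℝ) (x : Dataset s m k) : ℝ :=
  ∏ u : Fin s, ∏ j : Fin m, p (x u j)

/-- The `ℓ₁` distance. -/
def l1Dist {k : ℕ} (p q : Fin k → ℝ) : ℝ := ∑ i : Fin k, |p i - q i|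

/-- The expected `ℓ₁` error of the estimator `M` under `p`, over both the samples and the internal
randomness of `M`, as a value in `[0, ∞]`. -/
noncomputable def expectedLoss {s m k : ℕ} (M : Mechanism (Dataset s m k) (Fin k → ℝ))
    (p : Fin k → ℝ) : ℝ≥0∞ :=
  ∑ x : Dataset s m k, ENNReal.ofReal (sampleProb p x) *
    ∫⁻ q, ENNReal.ofReal (l1Dist p q) ∂(M x : Measure (Fin k → ℝ))

/-- An algorithm for `m` samples per user over `k` symbols: one mechanism for each number of users.
The estimates are vectors in `ℝᵏ`; those with values in the probability simplex are a special
case. -/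
abbrev Algorithm (m k : ℕ) : Type := ∀ s : ℕ, Mechanism (Dataset s m k) (Fin k → ℝ)

/-- The user complexity: the least number `s` of users with which the worst-case expected `ℓ₁`
error over all distributions on the `k` symbols is at most `α` (`⊤` if there is none). -/
noncomputable def userComplexity {m k : ℕ} (A : Algorithm m k) (α : ℝ) : ℕ∞ :=
  ⨅ s ∈ {s : ℕ | (⨆ p ∈ stdSimplex ℝ (Fin k), expectedLoss (A s) p) ≤ ENNReal.ofReal α}, (s : ℕ∞)

end UserLevelDP

/-! The argument is Assouad's lemma. Split the symbols into `h = ⌊k/2⌋` pairs and give the two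
members of each pair weights `(1 ± γ) / (2h)` with `γ = 3α`, the signs being hidden. Misordering a
pair costs `γ/h` in `ℓ₁`, so if flipping one sign moves the probability of each read-off by at most
`τ`, an average over sign vectors gives `γ(1 - τ) ≤ 2α` (`mul_le_of_expectedLoss_le`). For `τ = 1/4`
this is false, so some flip must be visible. Two bounds on its effect give the two terms.

Statistical term: a flip has per-sample `χ²` divergence of order `γ²/h`, so it is invisible unless
`sm` is of order `k/α²` (`pairMean_sub_flipAt_le_chiSq`).

Privacy term: couple the two product laws so that each sample differs with probability `γ/h`. Only
counts are seen, so the differing samples may be rearranged into as few users as possible: `D`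
differences touch `⌈D/m⌉` users, each costing `e^ε - 1 + δ`. As `E D = smγ/h`, the factor `m`
cancels (`pairMean_sub_flipAt_le_lipschitz`). -/

namespace UserLevelDP

/-! ### Means over i.i.d. words: change of alphabet and of weights -/

section IID

variable {ι B B' : Type*} [Fintype ι] [DecidableEq ι] [Fintype B] [Fintype B']

/-- The mean of `F` over a word indexed by `ι` whose letters are i.i.d. with weights `w`. -/
def iidMean (w : B → ℝ) (F : (ι → B) → ℝ) : ℝ := ∑ x : ι → B, (∏ i, w (x i)) * F x

theorem sum_prod_apply (W : ι → B → ℝ) : ∑ x : ι → B, ∏ i, W i (x i) = ∏ i, ∑ b, W i b := by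
  classical
  rw [Finset.prod_univ_sum, Fintype.piFinset_univ]

theorem iidMean_prod (w r : B → ℝ) :
    iidMean w (fun x : ι → B => ∏ i, r (x i)) = (∑ b, w b * r b) ^ Fintype.card ι := by
  simp only [iidMean, ← Finset.prod_mul_distrib]
  rw [sum_prod_apply (fun _ b => w b * r b), Finset.prod_const, Finset.card_univ]

theorem iidMean_const {w : B → ℝ} (hw : ∑ b, w b = 1) (c : ℝ) :
    iidMean w (fun _ : ι → B => c) = c := by
  have h := iidMean_prod (ι := ι) w (fun _ => 1)
  simp only [iidMean, Finset.prod_const_one, mul_one, hw, one_pow] at h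
  rw [iidMean, ← Finset.sum_mul, h, one_mul]

theorem iidMean_add (w : B → ℝ) (F G : (ι → B) → ℝ) :
    iidMean w (fun x => F x + G x) = iidMean w F + iidMean w G := by
  simp only [iidMean, mul_add, Finset.sum_add_distrib]

theorem iidMean_sub (w : B → ℝ) (F G : (ι → B) → ℝ) :
    iidMean w (fun x => F x - G x) = iidMean w F - iidMean w G := by
  simp only [iidMean, mul_sub, Finset.sum_sub_distrib]

theorem iidMean_const_mul (w : B → ℝ) (c : ℝ) (F : (ι → B) → ℝ) :
    iidMean w (fun x => c * F x) = c * iidMean w F := by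
  simp only [iidMean, Finset.mul_sum]
  exact Finset.sum_congr rfl fun x _ => by ring

theorem iidMean_finsetSum {κ : Type*} (w : B → ℝ) (t : Finset κ) (F : κ → (ι → B) → ℝ) :
    iidMean w (fun x => ∑ a ∈ t, F a x) = ∑ a ∈ t, iidMean w (F a) := by
  simp only [iidMean, Finset.mul_sum]
  exact Finset.sum_comm

theorem iidMean_mono {w : B → ℝ} (hw : ∀ b, 0 ≤ w b) {F G : (ι → B) → ℝ} (h : ∀ x, F x ≤ G x) :
    iidMean w F ≤ iidMean w G :=
  Finset.sum_le_sum fun x _ =>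
    mul_le_mul_of_nonneg_left (h x) (Finset.prod_nonneg fun i _ => hw (x i))

theorem iidMean_apply {w : B → ℝ} (hw : ∑ b, w b = 1) (i₀ : ι) (f : B → ℝ) :
    iidMean w (fun x : ι → B => f (x i₀)) = ∑ b, w b * f b := by
  have h := sum_prod_apply (fun (i : ι) b => w b * if i = i₀ then f b else 1)
  have hL : ∀ x : ι → B, ∏ i, (w (x i) * if i = i₀ then f (x i) else 1)
      = (∏ i, w (x i)) * f (x i₀) := fun x => by
    rw [Finset.prod_mul_distrib, Finset.prod_ite_eq' Finset.univ i₀, if_pos (Finset.mem_univ _)]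
  have hR : ∀ i : ι, (∑ b, w b * if i = i₀ then f b else 1)
      = if i = i₀ then ∑ b, w b * f b else 1 := fun i => by
    split_ifs <;> simp [hw]
  simp only [hL, hR, Finset.prod_ite_eq', Finset.mem_univ, if_true] at h
  exact h

/-- Change of alphabet. -/
theorem iidMean_map [DecidableEq B] (g : B' → B) (w : B → ℝ) (w' : B' → ℝ)
    (h : ∀ b, w b = ∑ c with g c = b, w' c) (F : (ι → B) → ℝ) :
    iidMean w F = iidMean w' (fun y => F (g ∘ y)) := by
  classical
  unfold iidMean
  rw [← Finset.sum_fiberwise (s := (Finset.univ : Finset (ι → B'))) (g := fun y => g ∘ y)]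
  refine Finset.sum_congr rfl fun x _ => ?_
  have hx : ∑ y : ι → B' with g ∘ y = x, (∏ i, w' (y i)) * F (g ∘ y)
      = ∑ y : ι → B' with g ∘ y = x, (∏ i, w' (y i)) * F x :=
    Finset.sum_congr rfl fun y hy => by rw [(Finset.mem_filter.1 hy).2]
  rw [hx, ← Finset.sum_mul]
  congr 1
  simp only [h]
  rw [Finset.prod_univ_sum]
  refine Finset.sum_congr ?_ fun _ _ => rfl
  ext y
  simp [Fintype.mem_piFinset, funext_iff]

/-- A `χ²` bound for the change of mean of a bounded function under a change of weights. -/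
theorem iidMean_sub_le_of_ratio {w w' r : B → ℝ} (hw' : ∀ b, 0 ≤ w' b) (hs : ∑ b, w b = 1)
    (hs' : ∑ b, w' b = 1) (hr : ∀ b, w b = w' b * r b) {c : ℝ} (hc : ∑ b, w' b * r b ^ 2 ≤ 1 + c)
    {F : (ι → B) → ℝ} (hF₀ : ∀ x, 0 ≤ F x) (hF₁ : ∀ x, F x ≤ 1) {t : ℝ} (ht : 0 < t) :
    iidMean w F - iidMean w' F ≤ t / 2 + ((1 + c) ^ Fintype.card ι - 1) / (2 * t) := by
  have h1 : iidMean w F = iidMean w' (fun x => (∏ i, r (x i)) * F x) := by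
    unfold iidMean
    refine Finset.sum_congr rfl fun x _ => ?_
    simp only [hr, Finset.prod_mul_distrib]
    ring
  have h2 : iidMean w' (fun x : ι → B => ∏ i, r (x i)) = 1 := by
    rw [iidMean_prod]
    simp only [← hr, hs, one_pow]
  have h3 : iidMean w' (fun x : ι → B => ∏ i, r (x i) ^ 2) ≤ (1 + c) ^ Fintype.card ι := by
    rw [iidMean_prod w' (fun b => r b ^ 2)]
    exact pow_le_pow_left₀ (Finset.sum_nonneg fun b _ => mul_nonneg (hw' b) (sq_nonneg _)) hc _
  -- For the likelihood ratio `R`, AM-GM gives `(R - 1) F ≤ t/2 + (R - 1)² / (2t)`. Expanding the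
  -- square leaves only the means of `R` and `R²`, which factor over the letters.
  have h4 : ∀ x : ι → B, (∏ i, r (x i)) * F x - F x ≤
      (t / 2 + 1 / (2 * t)) + ((1 / (2 * t)) * (∏ i, r (x i) ^ 2)
        - (1 / t) * ∏ i, r (x i)) := fun x => by
    rw [Finset.prod_pow]
    generalize (∏ i, r (x i)) = R
    have hf : F x ^ 2 ≤ 1 := pow_le_one₀ (hF₀ x) (hF₁ x)
    have e : (t / 2 + 1 / (2 * t)) + ((1 / (2 * t)) * R ^ 2 - (1 / t) * R) - (R * F x - F x)
        = (t ^ 2 * (1 - F x ^ 2) + (t * F x - (R - 1)) ^ 2) / (2 * t) := by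
      field_simp
      ring
    have : 0 ≤ (t ^ 2 * (1 - F x ^ 2) + (t * F x - (R - 1)) ^ 2) / (2 * t) := by
      have := mul_nonneg (sq_nonneg t) (sub_nonneg.2 hf)
      positivity
    linarith
  rw [h1, ← iidMean_sub]
  refine (iidMean_mono hw' h4).trans ?_
  rw [iidMean_add, iidMean_const hs', iidMean_sub, iidMean_const_mul, iidMean_const_mul, h2]
  have := mul_le_mul_of_nonneg_left h3 (by positivity : 0 ≤ 1 / (2 * t))
  have e : t / 2 + ((1 + c) ^ Fintype.card ι - 1) / (2 * t)
      = t / 2 + 1 / (2 * t) + (1 / (2 * t) * (1 + c) ^ Fintype.card ι - 1 / t * 1) := by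
    field_simp
    ring
  linarith

end IID

/-! ### Group privacy after packing the changed samples into few users -/

section Privacy

variable {s m k : ℕ}

theorem totalCounts_apply (x : Dataset s m k) (c : Fin k) :
    totalCounts x c = (Finset.univ.filter fun p : Fin s × Fin m => x p.1 p.2 = c).card := by
  simp only [totalCounts, userCounts, Finset.sum_apply, Finset.card_filter]
  rw [Fintype.sum_prod_type]

theorem totalCounts_curry_comp_perm (x : Fin s × Fin m → Fin k) (σ : Equiv.Perm (Fin s × Fin m)) :
    totalCounts (Function.curry (x ∘ σ)) = totalCounts (Function.curry x) := by
  funext c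
  simp only [totalCounts_apply]
  rw [Finset.card_filter, Finset.card_filter]
  exact Equiv.sum_comp σ fun p => if x p = c then 1 else 0

theorem exists_perm_forall_mem {P : Type*} [Fintype P] [DecidableEq P] (D T : Finset P)
    (h : D.card ≤ T.card) : ∃ σ : Equiv.Perm P, ∀ p, σ p ∈ D → p ∈ T := by
  obtain ⟨T', hT', hc⟩ := Finset.exists_subset_card_eq h
  have e : {x // x ∈ T'} ≃ {x // x ∈ D} := Fintype.equivOfCardEq (by simpa using hc)
  refine ⟨e.extendSubtype, fun p hp => hT' ?_⟩
  by_contra hn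
  exact e.extendSubtype_not_mem p hn hp

/-- The multiplicative loss becomes additive because probabilities are at most 1. An additive loss
accumulates linearly along a chain of users. -/
theorem IsDP.measureReal_le {R : Type*} [MeasurableSpace R] {ε δ : ℝ}
    {M : Mechanism (Dataset s m k) R} (hM : IsDP ε δ M) (hε : 0 ≤ ε) (hδ : 0 ≤ δ)
    {x y : Dataset s m k} (hxy : Adjacent x y) {S : Set R} (hS : MeasurableSet S) :
    (M x : Measure R).real S ≤ (M y : Measure R).real S + (Real.exp ε - 1 + δ) := by
  have h := hM x y hxy S hS
  have h' := ENNReal.toReal_mono (by finiteness) h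
  rw [ENNReal.toReal_add (by finiteness) (by finiteness), ENNReal.toReal_mul,
    ENNReal.toReal_ofReal (Real.exp_pos _).le, ENNReal.toReal_ofReal hδ] at h'
  have h1 : (M y : Measure R).real S ≤ 1 := measureReal_le_one
  have h0 : 0 ≤ (M y : Measure R).real S := measureReal_nonneg
  have he : 0 ≤ Real.exp ε - 1 := by linarith [Real.add_one_le_exp ε]
  change (M x : Measure R).real S ≤ Real.exp ε * (M y : Measure R).real S + δ at h'
  nlinarith [mul_le_mul_of_nonneg_left h1 he]

/-- A function of the aggregate counts that changes by at most `η` when one user changes their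
data changes by at most `η` times the number of users needed to hold all changed samples. -/
theorem sub_le_ceil_mul {B : Type*} {f : Dataset s m k → ℝ} {η : ℝ} (hη : 0 ≤ η) (hm : 1 ≤ m)
    (hf : ∀ x y, totalCounts x = totalCounts y → f x = f y)
    (hadj : ∀ x y, Adjacent x y → f x ≤ f y + η)
    [DecidableEq B] (g g' : B → Fin k) (z : B) (hg : ∀ b, b ≠ z → g b = g' b)
    (y : Fin s × Fin m → B) :
    f (Function.curry (g ∘ y)) - f (Function.curry (g' ∘ y)) ≤
      η * (1 + (∑ p, if y p = z then (1 : ℝ) else 0) / m) := by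
  set D : Finset (Fin s × Fin m) := Finset.univ.filter fun p => y p = z with hD
  have hDs : (∑ p, if y p = z then (1 : ℝ) else 0) = (D.card : ℝ) := by
    rw [hD, Finset.card_filter]
    push_cast
    rfl
  have hm' : (0 : ℝ) < m := by exact_mod_cast hm
  have hDc : D.card ≤ s * m := by
    simpa using Finset.card_le_univ D
  set t : ℕ := ⌈(D.card : ℝ) / m⌉₊ with ht
  have htD : D.card ≤ t * m := by
    have := Nat.le_ceil ((D.card : ℝ) / m)
    rw [div_le_iff₀ hm'] at this
    exact_mod_cast this
  have hts : t ≤ s := by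
    rw [ht, Nat.ceil_le, div_le_iff₀ hm']
    exact_mod_cast hDc
  set T : Finset (Fin s × Fin m) :=
    (Finset.univ.filter fun u : Fin s => (u : ℕ) < t) ×ˢ Finset.univ with hT
  have hTc : T.card = t * m := by
    rw [hT, Finset.card_product, Finset.card_univ, Fintype.card_fin, Fin.card_filter_val_lt,
      min_eq_right hts]
  obtain ⟨σ, hσ⟩ := exists_perm_forall_mem D T (by rw [hTc]; exact htD)
  -- Hybrids: after permuting by `σ`, the first `r` users already hold their new data. All differing
  -- positions lie with the first `t` users, so `H t` is the fully changed dataset.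
  let H : ℕ → Dataset s m k := fun r u j =>
    if (u : ℕ) < r then g' (y (σ (u, j))) else g (y (σ (u, j)))
  have hstep : ∀ r, f (H 0) ≤ f (H r) + η * r := by
    intro r
    induction r with
    | zero => simp
    | succ r ih =>
      have hle : f (H r) ≤ f (H (r + 1)) + η := by
        by_cases hr : r < s
        · refine hadj _ _ ⟨⟨r, hr⟩, fun v hv => ?_⟩
          have hv' : (v : ℕ) ≠ r := fun h => hv (Fin.ext h)
          funext j
          have : ((v : ℕ) < r) ↔ (v : ℕ) < r + 1 := by omega
          simp only [H, this]
        · have : H r = H (r + 1) := by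
            funext u j
            have h1 : (u : ℕ) < r := by have := u.2; omega
            have h2 : (u : ℕ) < r + 1 := by omega
            simp only [H, h1, h2]
          rw [this]
          linarith
      push_cast
      linarith
  have h0 : H 0 = Function.curry ((g ∘ y) ∘ σ) := by
    funext u j
    simp [H, Function.curry]
  have h1 : H t = Function.curry ((g' ∘ y) ∘ σ) := by
    funext u j
    simp only [H, Function.curry, Function.comp]
    split_ifs with hu
    · rfl
    · refine hg _ fun hz => hu ?_
      have := hσ (u, j) (by simpa [hD] using hz)
      simpa [hT] using this
  have h := hstep t
  rw [h0, h1, hf _ _ (totalCounts_curry_comp_perm (g ∘ y) σ),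
    hf _ _ (totalCounts_curry_comp_perm (g' ∘ y) σ)] at h
  have hceil : (t : ℝ) ≤ 1 + (D.card : ℝ) / m := by
    have := Nat.ceil_lt_add_one (by positivity : 0 ≤ (D.card : ℝ) / m)
    linarith
  rw [hDs]
  linarith [mul_le_mul_of_nonneg_left hceil hη]

end Privacy

end UserLevelDP

namespace UserLevelDP

/-! ### Assouad's lemma on paired symbols, and the effect of flipping one sign -/

section Assouad

variable {s m k h : ℕ}

/-- Reverse the `i`-th sign. -/
def flipAt (v : Fin h → Bool) (i : Fin h) : Fin h → Bool := Function.update v i (!v i)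

theorem flipAt_self (v : Fin h → Bool) (i : Fin h) : flipAt v i i = !v i := by
  simp [flipAt]

theorem flipAt_of_ne (v : Fin h → Bool) {i j : Fin h} (hij : j ≠ i) : flipAt v i j = v j := by
  simp [flipAt, hij]

theorem flipAt_flipAt (v : Fin h → Bool) (i : Fin h) : flipAt (flipAt v i) i = v := by
  simp [flipAt]

/-- Weights on `h` pairs of symbols: in each pair the symbol selected by `v` is the heavier. -/
noncomputable def pairWeight (γ : ℝ) (v : Fin h → Bool) (b : Fin h × Bool) : ℝ :=
  (if b.2 = v b.1 then 1 + γ else 1 - γ) / (2 * h)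

theorem pairWeight_nonneg {γ : ℝ} (hγ₀ : 0 ≤ γ) (hγ₁ : γ ≤ 1) (v : Fin h → Bool)
    (b : Fin h × Bool) : 0 ≤ pairWeight γ v b := by
  unfold pairWeight
  split_ifs
  · positivity
  · exact div_nonneg (by linarith) (by positivity)

theorem pairWeight_self (γ : ℝ) (v : Fin h → Bool) (i : Fin h) :
    pairWeight γ v (i, v i) = (1 + γ) / (2 * h) := by
  simp [pairWeight]

theorem pairWeight_not_self (γ : ℝ) (v : Fin h → Bool) (i : Fin h) :
    pairWeight γ v (i, !v i) = (1 - γ) / (2 * h) := by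
  simp [pairWeight]

theorem sum_pair (F : Fin h × Bool → ℝ) (v : Fin h → Bool) :
    ∑ b, F b = ∑ i, (F (i, v i) + F (i, !v i)) := by
  rw [Fintype.sum_prod_type]
  refine Finset.sum_congr rfl fun i _ => ?_
  cases v i <;> simp [add_comm]

theorem sum_pairWeight (hh : 0 < h) (γ : ℝ) (v : Fin h → Bool) : ∑ b, pairWeight γ v b = 1 := by
  have hh' : (h : ℝ) ≠ 0 := by positivity
  rw [sum_pair _ v]
  simp only [pairWeight_self, pairWeight_not_self]
  rw [Finset.sum_const, Finset.card_univ, Fintype.card_fin, nsmul_eq_mul]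
  field_simp
  ring

theorem pairWeight_flipAt_of_ne (γ : ℝ) (v : Fin h → Bool) {i j : Fin h} (hij : j ≠ i) (b : Bool) :
    pairWeight γ (flipAt v i) (j, b) = pairWeight γ v (j, b) := by
  simp [pairWeight, flipAt_of_ne v hij]

/-- The distribution on `k` symbols carried by `h` pairs of symbols. -/
noncomputable def pairDist (φ : Fin h × Bool → Fin k) (γ : ℝ) (v : Fin h → Bool) (c : Fin k) : ℝ :=
  ∑ b with φ b = c, pairWeight γ v b

theorem pairDist_apply {φ : Fin h × Bool → Fin k} (hφ : Function.Injective φ) (γ : ℝ)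
    (v : Fin h → Bool) (b : Fin h × Bool) : pairDist φ γ v (φ b) = pairWeight γ v b := by
  rw [pairDist, Finset.sum_eq_single b]
  · intro c hc hcb
    exact absurd (hφ (Finset.mem_filter.1 hc).2) hcb
  · simp

theorem pairDist_mem_stdSimplex (hh : 0 < h) (φ : Fin h × Bool → Fin k) {γ : ℝ} (hγ₀ : 0 ≤ γ)
    (hγ₁ : γ ≤ 1) (v : Fin h → Bool) : pairDist φ γ v ∈ stdSimplex ℝ (Fin k) := by
  refine ⟨fun c => Finset.sum_nonneg fun b _ => pairWeight_nonneg hγ₀ hγ₁ v b, ?_⟩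
  unfold pairDist
  rw [Finset.sum_fiberwise, sum_pairWeight hh]

/-- The estimates from which the `i`-th sign is read off as `false`. -/
def falseSet (φ : Fin h × Bool → Fin k) (i : Fin h) : Set (Fin k → ℝ) :=
  {q | q (φ (i, true)) < q (φ (i, false))}

theorem measurableSet_falseSet (φ : Fin h × Bool → Fin k) (i : Fin h) :
    MeasurableSet (falseSet φ i) :=
  measurableSet_lt (measurable_pi_apply _) (measurable_pi_apply _)

/-- The estimates from which the `i`-th sign of `v` is read off wrongly. -/
def errorSet (φ : Fin h × Bool → Fin k) (v : Fin h → Bool) (i : Fin h) : Set (Fin k → ℝ) :=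
  if v i then falseSet φ i else (falseSet φ i)ᶜ

theorem measurableSet_errorSet (φ : Fin h × Bool → Fin k) (v : Fin h → Bool) (i : Fin h) :
    MeasurableSet (errorSet φ v i) := by
  unfold errorSet
  split_ifs
  · exact measurableSet_falseSet φ i
  · exact (measurableSet_falseSet φ i).compl

theorem le_of_mem_errorSet {φ : Fin h × Bool → Fin k} {v : Fin h → Bool} {i : Fin h}
    {q : Fin k → ℝ} (hq : q ∈ errorSet φ v i) : q (φ (i, v i)) ≤ q (φ (i, !v i)) := by
  unfold errorSet falseSet at hq
  cases hv : v i
  · simpa [hv] using hq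
  · simp only [hv, if_true, Set.mem_ofPred_eq] at hq
    exact hq.le

/-- The true weights in a pair differ by `γ/h`. An estimate that orders the pair the wrong way, or
ties it, is off by at least this gap in total on the two symbols. -/
theorem sum_indicator_errorSet_le_l1Dist {φ : Fin h × Bool → Fin k} (hφ : Function.Injective φ)
    (γ : ℝ) (v : Fin h → Bool) (q : Fin k → ℝ) :
    ∑ i, (errorSet φ v i).indicator (fun _ => γ / h) q ≤ l1Dist (pairDist φ γ v) q := by
  have h1 : ∑ b, |pairWeight γ v b - q (φ b)| ≤ l1Dist (pairDist φ γ v) q := by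
    unfold l1Dist
    simp only [← pairDist_apply hφ γ v]
    rw [← Finset.sum_image (f := fun c => |pairDist φ γ v c - q c|) hφ.injOn]
    exact Finset.sum_le_sum_of_subset_of_nonneg (Finset.subset_univ _) fun _ _ _ => abs_nonneg _
  refine le_trans ?_ h1
  rw [sum_pair _ v]
  refine Finset.sum_le_sum fun i _ => ?_
  by_cases hq : q ∈ errorSet φ v i
  · rw [Set.indicator_of_mem hq, pairWeight_self, pairWeight_not_self]
    have h2 := le_of_mem_errorSet hq
    have h3 := le_abs_self ((1 + γ) / (2 * h) - q (φ (i, v i)))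
    have h4 := neg_abs_le ((1 - γ) / (2 * h) - q (φ (i, !v i)))
    have h5 : γ / h = (1 + γ) / (2 * h) - (1 - γ) / (2 * h) := by
      rw [← sub_div, show 1 + γ - (1 - γ) = 2 * γ by ring, mul_div_mul_left _ _ two_ne_zero]
    linarith
  · rw [Set.indicator_of_notMem hq]
    positivity

theorem sum_measureReal_errorSet_le {φ : Fin h × Bool → Fin k} (hφ : Function.Injective φ)
    {γ : ℝ} (hγ : 0 ≤ γ) (v : Fin h → Bool) (μ : ProbabilityMeasure (Fin k → ℝ)) :
    ENNReal.ofReal (∑ i, γ / h * (μ : Measure (Fin k → ℝ)).real (errorSet φ v i)) ≤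
      ∫⁻ q, ENNReal.ofReal (l1Dist (pairDist φ γ v) q) ∂(μ : Measure (Fin k → ℝ)) := by
  have hγh : 0 ≤ γ / h := by positivity
  calc ENNReal.ofReal (∑ i, γ / h * (μ : Measure (Fin k → ℝ)).real (errorSet φ v i))
      = ∑ i, ∫⁻ q, (errorSet φ v i).indicator (fun _ => ENNReal.ofReal (γ / h)) q
          ∂(μ : Measure (Fin k → ℝ)) := by
        rw [ENNReal.ofReal_sum_of_nonneg fun i _ => mul_nonneg hγh measureReal_nonneg]
        refine Finset.sum_congr rfl fun i _ => ?_
        rw [lintegral_indicator_const (measurableSet_errorSet φ v i), ENNReal.ofReal_mul hγh,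
          ofReal_measureReal]
    _ = ∫⁻ q, ∑ i, (errorSet φ v i).indicator (fun _ => ENNReal.ofReal (γ / h)) q
          ∂(μ : Measure (Fin k → ℝ)) :=
        (lintegral_finsetSum _ fun i _ =>
          measurable_const.indicator (measurableSet_errorSet φ v i)).symm
    _ ≤ _ := by
        refine lintegral_mono fun q => ?_
        refine le_trans (le_of_eq ?_)
          (ENNReal.ofReal_le_ofReal (sum_indicator_errorSet_le_l1Dist hφ γ v q))
        rw [ENNReal.ofReal_sum_of_nonneg fun i _ => Set.indicator_nonneg (fun _ _ => hγh) q]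
        refine Finset.sum_congr rfl fun i _ => ?_
        by_cases hq : q ∈ errorSet φ v i <;> simp [hq]

theorem sum_sampleProb_mul (p : Fin k → ℝ) (F : Dataset s m k → ℝ) :
    ∑ x, sampleProb p x * F x =
      iidMean p (fun x : Fin s × Fin m → Fin k => F (Function.curry x)) := by
  unfold iidMean
  rw [← Equiv.sum_comp (Equiv.curry (Fin s) (Fin m) (Fin k))]
  refine Finset.sum_congr rfl fun x _ => ?_
  rw [Fintype.prod_prod_type]
  rfl

theorem ofReal_iidMean_le_expectedLoss {p : Fin k → ℝ} (hp : ∀ c, 0 ≤ p c)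
    {M : Mechanism (Dataset s m k) (Fin k → ℝ)} {F : Dataset s m k → ℝ} (hF₀ : ∀ x, 0 ≤ F x)
    (hF : ∀ x, ENNReal.ofReal (F x) ≤
      ∫⁻ q, ENNReal.ofReal (l1Dist p q) ∂(M x : Measure (Fin k → ℝ))) :
    ENNReal.ofReal (iidMean p (fun x : Fin s × Fin m → Fin k => F (Function.curry x))) ≤
      expectedLoss M p := by
  have h0 : ∀ x : Dataset s m k, 0 ≤ sampleProb p x := fun x =>
    Finset.prod_nonneg fun u _ => Finset.prod_nonneg fun j _ => hp _
  rw [← sum_sampleProb_mul, ENNReal.ofReal_sum_of_nonneg fun x _ => mul_nonneg (h0 x) (hF₀ x)]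
  unfold expectedLoss
  refine Finset.sum_le_sum fun x _ => ?_
  rw [ENNReal.ofReal_mul (h0 x)]
  gcongr
  exact hF x

/-- The mean of `F` when the samples are i.i.d. with the distribution on pairs given by `v`. -/
noncomputable def pairMean (φ : Fin h × Bool → Fin k) (γ : ℝ) (v : Fin h → Bool)
    (F : Dataset s m k → ℝ) : ℝ :=
  iidMean (pairWeight γ v) (fun x : Fin s × Fin m → Fin h × Bool => F (Function.curry (φ ∘ x)))

/-- **Assouad's lemma**: if no single sign can be tested reliably, the loss is large. -/
theorem mul_le_of_expectedLoss_le (hh : 0 < h) {φ : Fin h × Bool → Fin k}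
    (hφ : Function.Injective φ) {γ α τ : ℝ} (hγ₀ : 0 ≤ γ) (hγ₁ : γ ≤ 1) (hα : 0 ≤ α)
    {M : Mechanism (Dataset s m k) (Fin k → ℝ)}
    (hM : ∀ p ∈ stdSimplex ℝ (Fin k), expectedLoss M p ≤ ENNReal.ofReal α)
    (hτ : ∀ (v : Fin h → Bool) (i : Fin h),
      pairMean φ γ v (fun x => (M x : Measure (Fin k → ℝ)).real (falseSet φ i)) -
        pairMean φ γ (flipAt v i) (fun x => (M x : Measure (Fin k → ℝ)).real (falseSet φ i)) ≤ τ) :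
    γ * (1 - τ) ≤ 2 * α := by
  have hγh : 0 ≤ γ / h := by positivity
  let err : (Fin h → Bool) → Fin h → ℝ := fun v i =>
    pairMean φ γ v (fun x => (M x : Measure (Fin k → ℝ)).real (errorSet φ v i))
  have hloss : ∀ v, ∑ i, γ / h * err v i ≤ α := fun v => by
    have hmem := pairDist_mem_stdSimplex hh φ hγ₀ hγ₁ v
    have h1 := (ofReal_iidMean_le_expectedLoss (F := fun x => ∑ i, γ / h *
      (M x : Measure (Fin k → ℝ)).real (errorSet φ v i)) hmem.1
      (fun x => Finset.sum_nonneg fun i _ => mul_nonneg hγh measureReal_nonneg)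
      (fun x => sum_measureReal_errorSet_le hφ hγ₀ v (M x))).trans (hM _ hmem)
    rw [ENNReal.ofReal_le_ofReal_iff hα,
      iidMean_map φ (pairDist φ γ v) (pairWeight γ v) (fun _ => rfl), iidMean_finsetSum] at h1
    simp only [iidMean_const_mul] at h1
    exact h1
  have hpair : ∀ v i, 1 - τ ≤ err v i + err (flipAt v i) i := by
    -- The error events for the two signs are complementary, so the two error probabilities sum to 1
    -- minus a difference of means of the same event. The other sign follows by applying this to the
    -- flipped vector.
    have key : ∀ v i, v i = true → 1 - τ ≤ err v i + err (flipAt v i) i := fun v i hv => by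
      have hE : errorSet φ v i = falseSet φ i := by simp [errorSet, hv]
      have hE' : errorSet φ (flipAt v i) i = (falseSet φ i)ᶜ := by
        simp [errorSet, flipAt_self, hv]
      have hc : err (flipAt v i) i = 1 - pairMean φ γ (flipAt v i)
          (fun x => (M x : Measure (Fin k → ℝ)).real (falseSet φ i)) := by
        simp only [err, hE', probReal_compl_eq_one_sub (measurableSet_falseSet φ i)]
        unfold pairMean
        rw [iidMean_sub, iidMean_const (sum_pairWeight hh γ _)]
      have ht := hτ (flipAt v i) i
      rw [flipAt_flipAt] at ht
      rw [hc]
      simp only [err, hE]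
      linarith
    intro v i
    cases hv : v i
    · have := key (flipAt v i) i (by simp [flipAt_self, hv])
      rw [flipAt_flipAt] at this
      linarith
    · exact key v i hv
  have hsum : ∀ i, ∑ v, err (flipAt v i) i = ∑ v, err v i := fun i =>
    Equiv.sum_comp (Function.Involutive.toPerm (fun v => flipAt v i) fun v => flipAt_flipAt v i)
      fun v => err v i
  obtain ⟨N, hNc⟩ : ∃ N : ℝ, ((Fintype.card (Fin h → Bool) : ℕ) : ℝ) = N := ⟨_, rfl⟩
  have hN : 0 < N := by
    rw [← hNc]
    exact_mod_cast Fintype.card_pos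
  have hi : ∀ i, N * (1 - τ) ≤ 2 * ∑ v, err v i := fun i => by
    have := Finset.sum_le_sum fun v (_ : v ∈ Finset.univ) => hpair v i
    rw [Finset.sum_add_distrib, hsum, Finset.sum_const, Finset.card_univ, nsmul_eq_mul, hNc] at this
    linarith
  have hA : ∑ v, ∑ i, γ / h * err v i ≤ N * α := by
    have := Finset.sum_le_sum fun v (_ : v ∈ Finset.univ) => hloss v
    rwa [Finset.sum_const, Finset.card_univ, nsmul_eq_mul, hNc] at this
  rw [Finset.sum_comm] at hA
  have hB : (h : ℝ) * (γ / h * (N * (1 - τ) / 2)) ≤ ∑ i, ∑ v, γ / h * err v i := by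
    have : ∑ _i : Fin h, (γ / h * (N * (1 - τ) / 2)) ≤ ∑ i, ∑ v, γ / h * err v i := by
      refine Finset.sum_le_sum fun i _ => ?_
      rw [← Finset.mul_sum]
      exact mul_le_mul_of_nonneg_left (by linarith [hi i]) hγh
    rwa [Finset.sum_const, Finset.card_univ, Fintype.card_fin, nsmul_eq_mul] at this
  have hh' : (h : ℝ) ≠ 0 := by positivity
  have e : (h : ℝ) * (γ / h * (N * (1 - τ) / 2)) = N * (γ * (1 - τ) / 2) := by
    field_simp
  rw [e] at hB
  have := le_of_mul_le_mul_left (hB.trans hA) hN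
  linarith

/-- The likelihood ratio differs from 1 only on pair `i`, which has mass `1/h`. The `χ²` divergence
is exactly `4γ² / ((1 - γ²) h)`, and `γ ≤ 1/2` turns `4 / (1 - γ²)` into `16/3`. -/
theorem pairMean_sub_flipAt_le_chiSq (hh : 0 < h) (φ : Fin h × Bool → Fin k) {γ : ℝ} (hγ₀ : 0 ≤ γ)
    (hγ₁ : γ ≤ 1 / 2) (v : Fin h → Bool) (i : Fin h) {F : Dataset s m k → ℝ} (hF₀ : ∀ x, 0 ≤ F x)
    (hF₁ : ∀ x, F x ≤ 1) {t : ℝ} (ht : 0 < t) :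
    pairMean φ γ v F - pairMean φ γ (flipAt v i) F ≤
      t / 2 + ((1 + 16 / 3 * γ ^ 2 / h) ^ (s * m) - 1) / (2 * t) := by
  have hh' : (h : ℝ) ≠ 0 := by positivity
  have hm : 1 - γ ≠ 0 := by linarith
  have hp : 1 + γ ≠ 0 := by linarith
  let r : Fin h × Bool → ℝ := fun b =>
    if b.1 = i then if b.2 = v i then (1 + γ) / (1 - γ) else (1 - γ) / (1 + γ) else 1
  have hflip : flipAt v i i = !v i := flipAt_self v i
  have hr : ∀ b, pairWeight γ v b = pairWeight γ (flipAt v i) b * r b := by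
    rintro ⟨j, c⟩
    by_cases hj : j = i
    · subst hj
      simp only [r, pairWeight, hflip, if_true]
      cases c <;> cases v j <;> simp <;> field_simp
    · simp [r, hj, pairWeight_flipAt_of_ne]
  have hc : ∑ b, pairWeight γ (flipAt v i) b * r b ^ 2 ≤ 1 + 16 / 3 * γ ^ 2 / h := by
    have e : ∀ b, pairWeight γ (flipAt v i) b * r b ^ 2 = pairWeight γ v b * r b := fun b => by
      rw [hr b]
      ring
    simp only [e]
    rw [sum_pair _ v]
    have e2 : ∀ j, pairWeight γ v (j, v j) * r (j, v j) + pairWeight γ v (j, !v j) * r (j, !v j)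
        = 1 / h + if j = i then 4 * γ ^ 2 / (1 - γ ^ 2) / h else 0 := fun j => by
      have hq : 1 - γ ^ 2 ≠ 0 := by
        rw [show 1 - γ ^ 2 = (1 - γ) * (1 + γ) by ring]
        exact mul_ne_zero hm hp
      rw [pairWeight_self, pairWeight_not_self]
      by_cases hj : j = i
      · subst hj
        simp only [r, if_true, Bool.not_eq_self, if_false]
        rw [show 1 - γ ^ 2 = (1 - γ) * (1 + γ) by ring]
        field_simp
        ring
      · simp only [r, hj, if_false]
        field_simp
        ring
    simp only [e2]
    rw [Finset.sum_add_distrib, Finset.sum_const, Finset.card_univ, Fintype.card_fin, nsmul_eq_mul,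
      mul_one_div_cancel hh', Finset.sum_ite_eq' Finset.univ i, if_pos (Finset.mem_univ _)]
    have : 4 * γ ^ 2 / (1 - γ ^ 2) ≤ 16 / 3 * γ ^ 2 := by
      rw [div_le_iff₀ (by nlinarith)]
      nlinarith [mul_nonneg (sq_nonneg γ) (by nlinarith : 0 ≤ 1 / 4 - γ ^ 2)]
    gcongr
  have := iidMean_sub_le_of_ratio (ι := Fin s × Fin m)
    (fun b => pairWeight_nonneg hγ₀ (by linarith) (flipAt v i) b)
    (sum_pairWeight hh γ v) (sum_pairWeight hh γ (flipAt v i)) hr hc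
    (F := fun x => F (Function.curry (φ ∘ x))) (fun x => hF₀ _) (fun x => hF₁ _) ht
  rwa [Fintype.card_prod, Fintype.card_fin, Fintype.card_fin] at this

/-- Maximal coupling of the two laws, sample by sample; the summand 1 pays for rounding up the
number of users. -/
theorem pairMean_sub_flipAt_le_lipschitz (hh : 0 < h) (hm : 1 ≤ m) (φ : Fin h × Bool → Fin k)
    {γ : ℝ} (hγ₀ : 0 ≤ γ) (hγ₁ : γ ≤ 1) (v : Fin h → Bool) (i : Fin h) {F : Dataset s m k → ℝ}
    {η : ℝ} (hη : 0 ≤ η) (hF : ∀ x y, totalCounts x = totalCounts y → F x = F y)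
    (hadj : ∀ x y, Adjacent x y → F x ≤ F y + η) :
    pairMean φ γ v F - pairMean φ γ (flipAt v i) F ≤ η * (1 + s * (γ / h)) := by
  have hh' : (h : ℝ) ≠ 0 := by positivity
  have hm' : (m : ℝ) ≠ 0 := by positivity
  -- Letters `some b` carry the common part of the two laws; `none` carries the excess `γ/h`,
  -- decoded as the heavier symbol of pair `i` under either sign.
  let w : Option (Fin h × Bool) → ℝ := fun b =>
    b.elim (γ / h) fun b => if b.1 = i then (1 - γ) / (2 * h) else pairWeight γ v b
  have hw0 : ∀ b, 0 ≤ w b := by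
    rintro (_ | b)
    · exact div_nonneg hγ₀ (by positivity)
    · simp only [w, Option.elim_some]
      split_ifs
      · exact div_nonneg (by linarith) (by positivity)
      · exact pairWeight_nonneg hγ₀ hγ₁ v b
  have hmap : ∀ (u : Fin h → Bool), (∀ j, j ≠ i → u j = v j) → ∀ b, pairWeight γ u b =
      ∑ c with Option.getD c (i, u i) = b, w c := fun u hu b => by
    rw [Finset.sum_filter, Fintype.sum_option]
    simp only [Option.getD_none, Option.getD_some, Finset.sum_ite_eq', Finset.mem_univ, if_true]
    obtain ⟨j, c⟩ := b
    by_cases hj : j = i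
    · subst hj
      by_cases hc : c = u j
      · subst hc
        simp only [w, pairWeight, if_true, Option.elim_none, Option.elim_some]
        field_simp
        ring
      · simp [w, pairWeight, hc, Ne.symm hc]
    · simp [w, pairWeight, hj, Ne.symm hj, hu j hj]
  have hws : ∑ c, w c = 1 := by
    rw [← sum_pairWeight hh γ v, ← Finset.sum_fiberwise Finset.univ
      (fun c => Option.getD c (i, v i)) w]
    exact Finset.sum_congr rfl fun b _ => (hmap v (fun _ _ => rfl) b).symm
  unfold pairMean
  rw [iidMean_map (fun c => Option.getD c (i, v i)) _ w (hmap v fun _ _ => rfl),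
    iidMean_map (fun c => Option.getD c (i, flipAt v i i)) _ w
      (hmap (flipAt v i) fun j hj => flipAt_of_ne v hj), ← iidMean_sub]
  refine (iidMean_mono hw0 (G := fun y => η * (1 + (1 / m) *
    ∑ p, if y p = none then (1 : ℝ) else 0)) fun y => ?_).trans (le_of_eq ?_)
  · have := sub_le_ceil_mul hη hm hF hadj (fun c => φ (Option.getD c (i, v i)))
      (fun c => φ (Option.getD c (i, flipAt v i i))) none (by rintro (_ | b) hb <;> simp_all) y
    rw [one_div_mul_eq_div]
    exact this
  · rw [iidMean_const_mul, iidMean_add, iidMean_const hws, iidMean_const_mul, iidMean_finsetSum]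
    simp only [iidMean_apply hws _ fun c : Option (Fin h × Bool) => if c = none then (1 : ℝ) else 0]
    simp only [mul_ite, mul_one, mul_zero, Finset.sum_ite_eq', Finset.mem_univ, if_true,
      Finset.sum_const, Finset.card_univ, Fintype.card_prod, Fintype.card_fin, nsmul_eq_mul]
    simp only [w, Option.elim_none]
    push_cast
    field_simp

end Assouad

end UserLevelDP

/-! ### Choice of constants and the two lower bounds -/

namespace UserLevelDP

/-- The `h = k / 2` pairs of symbols `2 i`, `2 i + 1`. -/
def pairSymbol (k : ℕ) (b : Fin (k / 2) × Bool) : Fin k :=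
  ⟨2 * b.1 + b.2.toNat, by have := b.1.2; have := b.2.toNat_le; omega⟩

theorem pairSymbol_injective (k : ℕ) : Function.Injective (pairSymbol k) := by
  rintro ⟨i, b⟩ ⟨j, c⟩ h
  have h' := congrArg Fin.val h
  simp only [pairSymbol] at h'
  have hb := b.toNat_le
  have hc := c.toNat_le
  have hbc : b.toNat = c.toNat := by omega
  rw [Prod.mk.injEq]
  exact ⟨Fin.ext (by omega), by cases b <;> cases c <;> simp_all⟩

theorem exp_mul_one_sub_le_one (x : ℝ) : Real.exp x * (1 - x) ≤ 1 := by
  have h := mul_le_mul_of_nonneg_left (Real.one_sub_le_exp_neg x) (Real.exp_pos x).le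
  rwa [← Real.exp_add, add_neg_cancel, Real.exp_zero] at h

theorem le_three_mul_half {k : ℕ} (hk : 2 ≤ k) : (k : ℝ) ≤ 3 * (k / 2 : ℕ) := by
  have : k ≤ 3 * (k / 2) := by omega
  exact_mod_cast this

/-- Assouad with `γ = 3α` and `τ = 1/4` would give `9α/4 ≤ 2α`. The condition `α < 1/6` keeps `γ`
below `1/2`. -/
theorem not_small_of_pairMean_sub_le {s m k : ℕ} (hk : 2 ≤ k) {α : ℝ} (hα₀ : 0 < α)
    (hα₁ : α < 1 / 6) {M : Mechanism (Dataset s m k) (Fin k → ℝ)}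
    (hM : ∀ p ∈ stdSimplex ℝ (Fin k), expectedLoss M p ≤ ENNReal.ofReal α) :
    ¬ ∀ (v : Fin (k / 2) → Bool) (i : Fin (k / 2)),
      pairMean (pairSymbol k) (3 * α) v
          (fun x => (M x : Measure (Fin k → ℝ)).real (falseSet (pairSymbol k) i)) -
        pairMean (pairSymbol k) (3 * α) (flipAt v i)
          (fun x => (M x : Measure (Fin k → ℝ)).real (falseSet (pairSymbol k) i)) ≤ 1 / 4 := by
  intro hτ
  have := mul_le_of_expectedLoss_le (by omega) (pairSymbol_injective k) (by linarith)
    (by linarith) hα₀.le hM hτ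
  linarith

/-- The number of samples needed by any estimator, private or not. -/
theorem le_mul_samples_of_expectedLoss_le {s m k : ℕ} (hk : 2 ≤ k) {α : ℝ} (hα₀ : 0 < α)
    (hα₁ : α < 1 / 6) {M : Mechanism (Dataset s m k) (Fin k → ℝ)}
    (hM : ∀ p ∈ stdSimplex ℝ (Fin k), expectedLoss M p ≤ ENNReal.ofReal α) :
    (k : ℝ) ≤ 2880 * (s * (m * α ^ 2)) := by
  by_contra! hlt
  refine not_small_of_pairMean_sub_le hk hα₀ hα₁ hM fun v i => ?_
  have hh : 0 < k / 2 := by omega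
  refine (pairMean_sub_flipAt_le_chiSq hh (pairSymbol k) (by linarith) (by linarith) v i
    (fun x => measureReal_nonneg) (fun x => measureReal_le_one)
    (by norm_num : (0 : ℝ) < 1 / 3)).trans ?_
  have hk3 := le_three_mul_half hk
  have hh' : (0 : ℝ) < (k / 2 : ℕ) := by exact_mod_cast hh
  set h : ℝ := ((k / 2 : ℕ) : ℝ)
  have hc : 0 ≤ 16 / 3 * (3 * α) ^ 2 / h := by positivity
  -- Since `k ≤ 3h`, the left side is at most `48 · 3 / 2880 = 1/20`.
  have hx : (s * m : ℕ) * (16 / 3 * (3 * α) ^ 2 / h) ≤ 1 / 20 := by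
    rw [← mul_div_assoc, div_le_iff₀ hh']
    push_cast
    nlinarith
  have h1 : (1 + 16 / 3 * (3 * α) ^ 2 / h) ^ (s * m) ≤ Real.exp (1 / 20) := by
    refine le_trans (pow_le_pow_left₀ (by linarith) ?_ (s * m))
      ((Real.exp_nat_mul _ (s * m)).symm.le.trans (Real.exp_le_exp.2 hx))
    linarith [Real.add_one_le_exp (16 / 3 * (3 * α) ^ 2 / h)]
  have h2 := exp_mul_one_sub_le_one (1 / 20)
  have h3 : (1 + 16 / 3 * (3 * α) ^ 2 / h) ^ (s * m) - 1 ≤ 1 / 19 := by linarith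
  calc _ ≤ (1 : ℝ) / 3 / 2 + 1 / 19 / (2 * (1 / 3)) := by gcongr
    _ ≤ 1 / 4 := by norm_num

/-- The number of users needed by a private estimator restricted to the aggregate counts. -/
theorem le_mul_users_of_isDP {s m k : ℕ} (hk : 2 ≤ k) (hm : 1 ≤ m) {α ε δ : ℝ} (hα₀ : 0 < α)
    (hα₁ : α < 1 / 6) (hε : 0 ≤ ε) (hδ : 0 ≤ δ) (hεδ : ε + δ ≤ 0.07)
    {M : Mechanism (Dataset s m k) (Fin k → ℝ)} (hDP : IsDP ε δ M)
    (hres : IsRestricted totalCounts M)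
    (hM : ∀ p ∈ stdSimplex ℝ (Fin k), expectedLoss M p ≤ ENNReal.ofReal α) :
    (k : ℝ) ≤ 60 * (s * (α * (ε + δ))) := by
  by_contra! hlt
  refine not_small_of_pairMean_sub_le hk hα₀ hα₁ hM fun v i => ?_
  obtain ⟨M', hM'⟩ := hres
  have hh : 0 < k / 2 := by omega
  have hη : 0 ≤ Real.exp ε - 1 + δ := by linarith [Real.add_one_le_exp ε]
  refine (pairMean_sub_flipAt_le_lipschitz hh hm (pairSymbol k) (by linarith) (by linarith) v i hη
    (fun x y hxy => by rw [hM' x, hM' y, hxy])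
    (fun x y hxy => hDP.measureReal_le hε hδ hxy (measurableSet_falseSet _ i))).trans ?_
  have hk3 := le_three_mul_half hk
  have hh' : (0 : ℝ) < (k / 2 : ℕ) := by exact_mod_cast hh
  set h : ℝ := ((k / 2 : ℕ) : ℝ)
  have he : Real.exp ε - 1 + δ ≤ 1.1 * (ε + δ) := by
    have h1 := exp_mul_one_sub_le_one ε
    have h2 := Real.add_one_le_exp ε
    nlinarith
  have hx : (ε + δ) * (s * (3 * α / h)) ≤ 3 / 20 := by
    rw [← mul_div_assoc, ← mul_div_assoc, div_le_iff₀ hh']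
    linarith
  have hs : 0 ≤ s * (3 * α / h) := by positivity
  calc (Real.exp ε - 1 + δ) * (1 + s * (3 * α / h))
      ≤ 1.1 * (ε + δ) * (1 + s * (3 * α / h)) := by gcongr
    _ = 1.1 * ((ε + δ) + (ε + δ) * (s * (3 * α / h))) := by ring
    -- Here `ε + δ ≤ 0.07` absorbs the rounding term: `1.1 · (0.07 + 0.15) = 0.242`.
    _ ≤ 1 / 4 := by linarith

end UserLevelDP

theorem mainTheorem3 :
    ∃ C : ℝ, 0 < C ∧
      ∀ (k m : ℕ) (α ε δ : ℝ), 2 ≤ k → 1 ≤ m → 0 < α → α < 1 / 6 →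
        0 ≤ ε → 0 ≤ δ → ε + δ ≤ 0.07 →
        ∀ A : UserLevelDP.Algorithm m k,
          (∀ s : ℕ, UserLevelDP.IsDP ε δ (A s)) →
          (∀ s : ℕ, UserLevelDP.IsRestricted UserLevelDP.totalCounts (A s)) →
          ENNReal.ofReal C *
              (ENNReal.ofReal ((k : ℝ) / ((m : ℝ) * α ^ 2)) +
                (k : ℝ≥0∞) / ENNReal.ofReal (α * (ε + δ))) ≤
            ((UserLevelDP.userComplexity A α : ℕ∞) : ℝ≥0∞) := by
  -- The two bounds add up to at most `(2880 + 60) s`, below `5760 s`.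
  refine ⟨1 / 5760, by norm_num, fun k m α ε δ hk hm hα₀ hα₁ hε hδ hεδ A hDP hres => ?_⟩
  have hk0 : (0 : ℝ) < k := by exact_mod_cast (by omega : 0 < k)
  have hm0 : (0 : ℝ) < m := by exact_mod_cast (by omega : 0 < m)
  have hbd : ∀ s ∈ {s : ℕ | (⨆ p ∈ stdSimplex ℝ (Fin k), UserLevelDP.expectedLoss (A s) p) ≤
      ENNReal.ofReal α}, (k : ℝ) ≤ 2880 * (s * (m * α ^ 2)) ∧
      (k : ℝ) ≤ 60 * (s * (α * (ε + δ))) := fun s hs => by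
    have hM := hs
    rw [Set.mem_ofPred_eq, iSup₂_le_iff] at hM
    exact ⟨UserLevelDP.le_mul_samples_of_expectedLoss_le hk hα₀ hα₁ hM,
      UserLevelDP.le_mul_users_of_isDP hk hm hα₀ hα₁ hε hδ hεδ (hDP s) (hres s) hM⟩
  rcases (add_nonneg hε hδ).eq_or_lt with h0 | hpos
  -- With `ε = δ = 0` the privacy bound reads `k ≤ 0`, so no `s` is admissible and the infimum is
  -- over an empty set.
  · have htop : UserLevelDP.userComplexity A α = ⊤ := by
      refine top_le_iff.1 (le_iInf₂ fun s hs => absurd (hbd s hs).2 ?_)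
      rw [← h0, mul_zero, mul_zero, mul_zero]
      exact hk0.not_ge
    rw [htop]
    exact le_top
  · have hαρ : 0 < α * (ε + δ) := mul_pos hα₀ hpos
    have hB0 : 0 ≤ (k : ℝ) / (m * α ^ 2) := by positivity
    have hB1 : 0 ≤ (k : ℝ) / (α * (ε + δ)) := by positivity
    set B : ℝ := 1 / 5760 * ((k : ℝ) / (m * α ^ 2) + k / (α * (ε + δ))) with hB
    -- The infimum lives in `ℕ∞`, so the real bound is rounded up before the comparison.
    have hle : ((⌈B⌉₊ : ℕ) : ℕ∞) ≤ UserLevelDP.userComplexity A α := by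
      refine le_iInf₂ fun s hs => ?_
      obtain ⟨h1, h2⟩ := hbd s hs
      rw [Nat.cast_le, Nat.ceil_le, hB]
      have h1' : (k : ℝ) / (m * α ^ 2) ≤ 2880 * s := by
        rw [div_le_iff₀ (by positivity)]
        linarith
      have h2' : (k : ℝ) / (α * (ε + δ)) ≤ 60 * s := by
        rw [div_le_iff₀ hαρ]
        linarith
      have : (0 : ℝ) ≤ s := Nat.cast_nonneg s
      linarith
    calc _ = ENNReal.ofReal B := by
          rw [hB, ENNReal.ofReal_mul (p := 1 / 5760) (by norm_num), ENNReal.ofReal_add hB0 hB1,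
            ENNReal.ofReal_div_of_pos hαρ, ENNReal.ofReal_natCast]
      _ ≤ ENNReal.ofReal (⌈B⌉₊ : ℝ) := ENNReal.ofReal_le_ofReal (Nat.le_ceil B)
      _ = (((⌈B⌉₊ : ℕ) : ℕ∞) : ℝ≥0∞) := by simp
      _ ≤ _ := ENat.toENNReal_le.2 hle
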